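/- Let $E,F$ be standard Borel spaces, $\pi$ a probability measure on $E$, $T:E\to F$ a measurable map, $\mathcal C_T\subset\mathcal P(F)$ a convex set of probability measures, and $\mathcal C=\{\eta\in\mathcal P(E): T\sharp\eta\in\mathcal C_T\}$, where $T\sharp\eta$ is the push-forward of $\eta$ by $T$. Write $\mathrm{Ent}(\eta\mid\mu)\in[0,+\infty]$ for the relative entropy (Kullback–Leibler divergence) of $\eta$ with respect to $\mu$. Assume that $\mathcal C$ contains a distribution $\mu_*$ with $h_*:=\mathrm{Ent}(\mu_*\mid\pi)=\min_{\eta\in\mathcal C}\mathrm{Ent}(\eta\mid\pi)<+\infty$. Let $\mathcal A\subset\mathcal C$ be a set of admissible targets and, for $h\ge h_*$ and $\mu\in\mathcal P(E)$, let $$\mathrm{WLC}_h(\mu\mid\pi)=\sup_{\eta\in\mathcal A,\ \mathrm{Ent}(\eta\mid\pi)\le h}\mathrm{Ent}(\eta\mid\mu)-h .$$ Assume that: 1. for $T\sharp\pi$-almost every $t$, the conditional distribution $\pi(\,\cdot\mid T=t)$ is atomless; 2. $\mathcal A$ contains every distribution of $\mathcal C$ having an indicator density with respect to $\mu_*$,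 that is, every $\eta\in\mathcal C$ of the form $\eta=\mu_*(\,\cdot\mid B)$ with $B\subset E$ measurable and $\mu_*(B)>0$. Then for every real $h\ge h_*$: (a) for every bounded measurable $f:E\to\mathbb R$ there is $\eta\in\mathcal A$ with $\mathrm{Ent}(\eta\mid\pi)=h$ and $\int f\,d\eta\ge\int f\,d\mu_*$; (b) $\mathrm{WLC}_h(\mu_*\mid\pi)=-\mathrm{Ent}(\mu_*\mid\pi)$; (c) $\mathrm{WLC}_h(\mu\mid\pi)\ge\mathrm{WLC}_h(\mu_*\mid\pi)+\mathrm{Ent}(\mu_*\mid\mu)$ for every $\mu\in\mathcal P(E)$. In particular $\mu_*$ is the unique minimizer of $\mu\mapsto\mathrm{WLC}_h(\mu\mid\pi)$ over $\mathcal P(E)$. -/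

import Mathlib

open MeasureTheory ProbabilityTheory InformationTheory
open scoped ENNReal NNReal

noncomputable section

/-- Relative entropy (Kullback-Leibler divergence) `Ent(η | μ)` of `η` with respect to `μ`, as an
extended real number: `∫ log (dη/dμ) dη` if `η ≪ μ` and the logarithm is integrable,
and `+∞` otherwise. -/
def relEnt {E : Type*} [MeasurableSpace E] (η μ : ProbabilityMeasure E) : EReal :=
  ((klDiv (η : Measure E) (μ : Measure E) : ℝ≥0∞) : EReal)

/-- A set of probability distributions is convex if it contains all the mixtures
`a • ν₁ + b • ν₂`, `a, b ≥ 0`, `a + b = 1`, of its elements. -/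
def ConvexClass {F : Type*} [MeasurableSpace F] (S : Set (ProbabilityMeasure F)) : Prop :=
  Convex ℝ≥0 ((fun ν : ProbabilityMeasure F => (ν : Measure F)) '' S)

/-- The class of the distributions `η` on `E` whose push-forward by `T` lies in `CT`. -/
def pullbackClass {E F : Type*} [MeasurableSpace E] [MeasurableSpace F] (T : E → F)
    (hT : Measurable T) (CT : Set (ProbabilityMeasure F)) : Set (ProbabilityMeasure E) :=
  {η | η.map hT.aemeasurable ∈ CT}

/-- `μ` minimizes the entropy relative to `π` over the class `C`, and belongs to `C`. -/
def IsEntropyMinimizer {E : Type*} [MeasurableSpace E] (π : ProbabilityMeasure E)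
    (C : Set (ProbabilityMeasure E)) (μ : ProbabilityMeasure E) : Prop :=
  μ ∈ C ∧ ∀ η ∈ C, relEnt μ π ≤ relEnt η π

/-- `η` has an indicator density with respect to `μ`: it is `μ` conditioned on a measurable set
`B` (of positive measure, since `η` is a probability distribution), that is
`η = μ(B)⁻¹ 1_B μ`. -/
def HasIndicatorDensity {E : Type*} [MeasurableSpace E] (η μ : ProbabilityMeasure E) : Prop :=
  ∃ B : Set E, MeasurableSet B ∧ (η : Measure E) = ProbabilityTheory.cond (μ : Measure E) B

/-- Worst-case log-cost of importance sampling with `μ` as compared to `π`, for the set `A` of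
admissible targets and the reference log-cost `h`:
the supremum of `Ent(η | μ)` over `η ∈ A` with `Ent(η | π) ≤ h`, minus `h`. -/
def WLC {E : Type*} [MeasurableSpace E] (A : Set (ProbabilityMeasure E)) (h : ℝ)
    (μ π : ProbabilityMeasure E) : EReal :=
  (⨆ η ∈ {η : ProbabilityMeasure E | η ∈ A ∧ relEnt η π ≤ (h : EReal)}, relEnt η μ) - (h : EReal)

end

/-!
Entropy minimization over a class of distributions defined by the law of a statistic `T`, and the
worst-case cost of sampling from the minimizer `μs`.

*Structure of the minimizer.* Moving from `μs` towards any `η` of the convex class does not decrease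
the entropy relative to `π`; differentiating along the segment gives the Pythagorean inequality
`Ent(η | μs) + Ent(μs | π) ≤ Ent(η | π)` (`klDiv_add_klDiv_le`). Applied to the distribution with
the law of `T` under `μs` and the conditional laws of `π` given `T`, together with data processing,
it shows that this distribution is `μs` itself (`IsEntropyMinimizer.map_prodMk`). Hence `dμs/dπ` is
a function of `T`, and the conditional laws of `μs` given `T` are atomless.

*The targets.* Ranking the points inside each fibre of `T` yields a circle-valued variable `V` which
is uniform and independent of `T` under `μs` (`exists_uniform_map_prodMk`). Conditioning `μs` on `V`
belonging to an arc of length `p` preserves the law of `T`, and so stays in the class; it shifts the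
entropy relative to `π` by exactly `-log p`, and `p = exp (Ent(μs | π) - h)` produces entropy `h`.
The arcs of length `p` average out to `p` times the whole space, so one of them does not decrease
the mean of a given integrable `f` (`exists_integral_le_integral_cond_arcEvent`). No comparison
within the fibres is required.

*The worst-case cost.* The Pythagorean inequality bounds the cost of `μs` from above. For a sampling
distribution `μ`, choosing `f = log (dμs/dμ)` bounds its cost from below when `Ent(μs | μ)` is
finite. Otherwise, as finitely many arcs cover the circle, conditioning on one of them already gives
an infinite entropy relative to `μ` (`klDiv_ne_top_of_cond`).
-/

/-! ### A fibrewise uniform variable -/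

/-- The cumulative distribution function of an atomless law is continuous. -/
theorem continuous_cdf_of_noAtoms (ν : Measure ℝ) [IsProbabilityMeasure ν] [NullSingletonClass ν] :
    Continuous (cdf ν) := by
  refine continuous_iff_continuousAt.2 fun x => ?_
  rw [(cdf ν).mono.continuousAt_iff_leftLim_eq_rightLim, (cdf ν).rightLim_eq]
  have h1 : (cdf ν).measure {x} = 0 := by rw [measure_cdf, measure_singleton]
  rw [StieltjesFunction.measure_singleton, ENNReal.ofReal_eq_zero] at h1
  exact le_antisymm ((cdf ν).mono.leftLim_le le_rfl) (by linarith)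

/-- Probability integral transform: an atomless law is mapped to the uniform law by its
cumulative distribution function. -/
theorem map_cdf_eq_volume_restrict (ν : Measure ℝ) [IsProbabilityMeasure ν] [NullSingletonClass ν] :
    ν.map (cdf ν) = volume.restrict (Set.Ioc 0 1) := by
  have hm : Measurable (cdf ν) := (cdf ν).mono.measurable
  have hex : ∀ a ∈ Set.Ioo (0 : ℝ) 1, ∃ c, cdf ν c = a := fun a ha =>
    mem_range_of_exists_le_of_exists_ge (continuous_cdf_of_noAtoms ν)
      (((tendsto_cdf_atBot ν).eventually (gt_mem_nhds ha.1)).exists.imp fun _ h => h.le)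
      (((tendsto_cdf_atTop ν).eventually (lt_mem_nhds ha.2)).exists.imp fun _ h => h.le)
  have hle : ∀ a ∈ Set.Ioo (0 : ℝ) 1, ν {x | cdf ν x ≤ a} ≤ ENNReal.ofReal a := by
    intro a ha
    have hstep : ∀ b ∈ Set.Ioo a 1, ν {x | cdf ν x ≤ a} ≤ ENNReal.ofReal b := by
      intro b hb
      obtain ⟨c, hc⟩ := hex b ⟨ha.1.trans hb.1, hb.2⟩
      rw [← hc, ofReal_cdf]
      refine measure_mono fun x hx => ?_
      by_contra hcx
      have := monotone_cdf ν (le_of_lt (not_le.1 hcx))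
      have h3 : cdf ν x ≤ a := hx
      linarith [hb.1]
    refine ge_of_tendsto (f := fun b : ℝ => ENNReal.ofReal b) (x := nhdsWithin a (Set.Ioi a)) ?_ ?_
    · exact (ENNReal.continuous_ofReal.tendsto a).mono_left nhdsWithin_le_nhds
    · filter_upwards [Ioo_mem_nhdsGT ha.2] with b hb using hstep b hb
  have hge : ∀ a ∈ Set.Ioo (0 : ℝ) 1, ENNReal.ofReal a ≤ ν {x | cdf ν x ≤ a} := by
    intro a ha
    obtain ⟨c, hc⟩ := hex a ha
    conv_lhs => rw [← hc, ofReal_cdf]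
    exact measure_mono fun x hx => (monotone_cdf ν hx).trans hc.le
  have : IsProbabilityMeasure (ν.map (cdf ν)) :=
    Measure.isProbabilityMeasure_map hm.aemeasurable
  refine Measure.ext_of_Iic _ _ fun a => ?_
  rw [Measure.map_apply hm measurableSet_Iic, Measure.restrict_apply measurableSet_Iic]
  change ν {x | cdf ν x ≤ a} = _
  rcases le_or_gt a 0 with h0 | h0
  · have h1 : Set.Iic a ∩ Set.Ioc (0 : ℝ) 1 = ∅ := by
      ext x; simp only [Set.mem_inter_iff, Set.mem_Iic, Set.mem_Ioc, Set.mem_empty_iff_false,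
        iff_false]; intro h; linarith [h.1, h.2.1]
    rw [h1, measure_empty]
    refine le_antisymm ?_ zero_le
    refine ge_of_tendsto (f := fun b : ℝ => ENNReal.ofReal b)
      (x := nhdsWithin 0 (Set.Ioi 0)) ?_ ?_
    · have := (ENNReal.continuous_ofReal.tendsto (0 : ℝ)).mono_left
        (nhdsWithin_le_nhds (s := Set.Ioi 0))
      simpa using this
    · filter_upwards [Ioo_mem_nhdsGT (zero_lt_one' ℝ)] with b hb
      exact (measure_mono fun x hx => le_trans (show cdf ν x ≤ a from hx)
        (h0.trans hb.1.le)).trans (hle b hb)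
  rcases lt_or_ge a 1 with h1 | h1
  · have h2 : Set.Iic a ∩ Set.Ioc (0 : ℝ) 1 = Set.Ioc 0 a := by
      ext x; simp only [Set.mem_inter_iff, Set.mem_Iic, Set.mem_Ioc]
      constructor
      · rintro ⟨h, h', _⟩; exact ⟨h', h⟩
      · rintro ⟨h, h'⟩; exact ⟨h', h, by linarith⟩
    rw [h2, Real.volume_Ioc, sub_zero]
    exact le_antisymm (hle a ⟨h0, h1⟩) (hge a ⟨h0, h1⟩)
  · have h2 : Set.Iic a ∩ Set.Ioc (0 : ℝ) 1 = Set.Ioc 0 1 :=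
      Set.inter_eq_right.2 fun x hx => hx.2.trans h1
    have h3 : {x | cdf ν x ≤ a} = Set.univ :=
      Set.eq_univ_of_forall fun x => (cdf_le_one ν x).trans h1
    rw [h2, h3, measure_univ, Real.volume_Ioc]; simp

/-- A Markov kernel into a standard Borel space admits a jointly measurable variable on the unit
circle which is uniform under each of its atomless laws: the rank of the points, once the space
is embedded into the line. -/
theorem exists_uniform_of_atomless_kernel {E F : Type*} [MeasurableSpace E] [StandardBorelSpace E]
    [MeasurableSpace F] (κ : Kernel F E) [IsMarkovKernel κ] :
    ∃ u : F × E → UnitAddCircle, Measurable u ∧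
      ∀ t, (∀ x, κ t {x} = 0) → (κ t).map (fun x => u (t, x)) = volume := by
  have hι := measurableEmbedding_embeddingReal E
  set ι := embeddingReal E
  let r : F × E → ℝ := fun q => (κ q.1 {y | ι y ≤ ι q.2}).toReal
  have hr : Measurable r := by
    have hs : MeasurableSet {z : (F × E) × E | ι z.2 ≤ ι z.1.2} :=
      measurableSet_le (hι.measurable.comp measurable_snd)
        (hι.measurable.comp (measurable_snd.comp measurable_fst))
    exact (Kernel.measurable_kernel_prodMk_left (κ := κ.comap Prod.fst measurable_fst)
      hs).ennreal_toReal
  have hmk : Measurable ((↑) : ℝ → UnitAddCircle) := (AddCircle.continuous_mk' 1).measurable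
  refine ⟨fun q => (r q : UnitAddCircle), hmk.comp hr, fun t ht => ?_⟩
  let ν := (κ t).map ι
  have hν : IsProbabilityMeasure ν :=
    Measure.isProbabilityMeasure_map hι.measurable.aemeasurable
  have hna : NullSingletonClass ν := ⟨fun a => by
    rw [hι.map_apply]
    have hsub : (ι ⁻¹' {a}).Subsingleton := fun x hx y hy => hι.injective (by
      rw [Set.mem_preimage, Set.mem_singleton_iff] at hx hy; rw [hx, hy])
    rcases hsub.eq_empty_or_singleton with h | ⟨x, h⟩
    · rw [h, measure_empty]
    · rw [h, ht x]⟩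
  have hrt : (fun x => ((r (t, x) : ℝ) : UnitAddCircle))
      = ((↑) : ℝ → UnitAddCircle) ∘ (cdf ν) ∘ ι := by
    funext x
    simp only [Function.comp, r, cdf_eq_real, measureReal_def, ν,
      Measure.map_apply hι.measurable measurableSet_Iic]
    rfl
  have hcm : Measurable (cdf ν) := (cdf ν).mono.measurable
  rw [hrt, ← Measure.map_map hmk (hcm.comp hι.measurable), ← Measure.map_map hcm hι.measurable]
  change (ν.map (cdf ν)).map _ = _
  rw [map_cdf_eq_volume_restrict]
  have := (UnitAddCircle.measurePreserving_mk 0).map_eq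
  simpa using this

/-! ### Conditioning on a rotated arc -/

/-- The event that the circle-valued variable `V` falls in the arc of length `p` centred at `s`. -/
def arcEvent {E : Type*} (V : E → UnitAddCircle) (p : ℝ) (s : UnitAddCircle) : Set E :=
  {x | V x ∈ Metric.closedBall s (p / 2)}

/-- The circle is compact, so finitely many arcs of a given positive length cover it. -/
theorem exists_finset_iUnion_arcEvent {E : Type*} (V : E → UnitAddCircle) {p : ℝ}
    (hp0 : 0 < p) :
    ∃ S : Finset UnitAddCircle, ⋃ s ∈ S, arcEvent V p s = Set.univ := by
  obtain ⟨S, -, hS⟩ := (isCompact_univ (X := UnitAddCircle)).elim_nhds_subcover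
    (fun s => Metric.closedBall s (p / 2)) (fun s _ => Metric.closedBall_mem_nhds s (by linarith))
  refine ⟨S, Set.eq_univ_of_forall fun x => ?_⟩
  have := hS (Set.mem_univ (V x))
  simpa [arcEvent] using this

section Arc

variable {E F : Type*} [MeasurableSpace E] [MeasurableSpace F]

variable {V : E → UnitAddCircle} {T : E → F} {m : Measure E} {p : ℝ}

theorem measurableSet_arcEvent (hV : Measurable V) (s : UnitAddCircle) :
    MeasurableSet (arcEvent V p s) :=
  hV Metric.isClosed_closedBall.measurableSet

theorem volume_arc (hp1 : p ≤ 1) (s : UnitAddCircle) :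
    volume (Metric.closedBall s (p / 2)) = ENNReal.ofReal p := by
  rw [AddCircle.volume_closedBall, mul_div_cancel₀ p two_ne_zero, min_eq_right hp1]

theorem measure_arcEvent_inter_preimage [IsProbabilityMeasure m] (hV : Measurable V)
    (hT : Measurable T) (hprod : m.map (fun x => (T x, V x)) = (m.map T).prod volume)
    (hp1 : p ≤ 1) (s : UnitAddCircle) {C : Set F} (hC : MeasurableSet C) :
    m (arcEvent V p s ∩ T ⁻¹' C) = ENNReal.ofReal p * m (T ⁻¹' C) := by
  have h1 : arcEvent V p s ∩ T ⁻¹' C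
      = (fun x => (T x, V x)) ⁻¹' (C ×ˢ Metric.closedBall s (p / 2)) := by
    ext x; simp [arcEvent, and_comm]
  rw [h1, ← Measure.map_apply (hT.prodMk hV)
    (hC.prod Metric.isClosed_closedBall.measurableSet), hprod, Measure.prod_prod,
    volume_arc hp1, Measure.map_apply hT hC, mul_comm]

theorem measure_arcEvent [IsProbabilityMeasure m] (hV : Measurable V)
    (hT : Measurable T) (hprod : m.map (fun x => (T x, V x)) = (m.map T).prod volume)
    (hp1 : p ≤ 1) (s : UnitAddCircle) : m (arcEvent V p s) = ENNReal.ofReal p := by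
  simpa using measure_arcEvent_inter_preimage hV hT hprod hp1 s MeasurableSet.univ

/-- Conditioning on an arc of a variable independent of `T` does not change the law of `T`. -/
theorem map_cond_arcEvent [IsProbabilityMeasure m] (hV : Measurable V)
    (hT : Measurable T) (hprod : m.map (fun x => (T x, V x)) = (m.map T).prod volume)
    (hp0 : 0 < p) (hp1 : p ≤ 1) (s : UnitAddCircle) :
    (cond m (arcEvent V p s)).map T = m.map T := by
  ext C hC
  rw [Measure.map_apply hT hC, Measure.map_apply hT hC,
    cond_apply (measurableSet_arcEvent hV s), measure_arcEvent hV hT hprod hp1,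
    measure_arcEvent_inter_preimage hV hT hprod hp1 s hC, ← mul_assoc,
    ENNReal.inv_mul_cancel (by simpa using hp0) ENNReal.ofReal_ne_top, one_mul]

/-- Some arc does at least as well as the average over all the arcs: since every point belongs
to a proportion `p` of the arcs, conditioning on a suitable one does not decrease the integral
of `f`. -/
theorem exists_integral_le_integral_cond_arcEvent [IsProbabilityMeasure m] (hV : Measurable V)
    (hT : Measurable T) (hprod : m.map (fun x => (T x, V x)) = (m.map T).prod volume)
    (hp0 : 0 < p) (hp1 : p ≤ 1) {f : E → ℝ} (hf : Integrable f m) :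
    ∃ s, ∫ x, f x ∂m ≤ ∫ x, f x ∂(cond m (arcEvent V p s)) := by
  let G : UnitAddCircle × E → ℝ :=
    {q : UnitAddCircle × E | V q.2 ∈ Metric.closedBall q.1 (p / 2)}.indicator (fun q => f q.2)
  have hS : MeasurableSet {q : UnitAddCircle × E | V q.2 ∈ Metric.closedBall q.1 (p / 2)} := by
    simp only [Metric.mem_closedBall]
    exact measurableSet_le ((hV.comp measurable_snd).dist measurable_fst) measurable_const
  have hG : Integrable G ((volume : Measure UnitAddCircle).prod m) :=
    (hf.comp_snd (volume : Measure UnitAddCircle)).indicator hS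
  have h1 : ∀ s, ∫ x, G (s, x) ∂m = ∫ x in arcEvent V p s, f x ∂m := fun s => by
    rw [← integral_indicator (measurableSet_arcEvent hV s)]; rfl
  have h2 : ∀ x, ∫ s, G (s, x) ∂(volume : Measure UnitAddCircle) = p * f x := fun x => by
    have : (fun s => G (s, x))
        = (Metric.closedBall (V x) (p / 2)).indicator (fun _ => f x) := by
      funext s
      simp only [G, Set.indicator, Set.mem_ofPred_eq, Metric.mem_closedBall, dist_comm]
    rw [this, integral_indicator_const _ Metric.isClosed_closedBall.measurableSet,
      measureReal_def, volume_arc hp1, ENNReal.toReal_ofReal hp0.le, smul_eq_mul]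
  have h3 : ∫ s, ∫ x in arcEvent V p s, f x ∂m ∂(volume : Measure UnitAddCircle)
      = p * ∫ x, f x ∂m := by
    simp_rw [← h1]
    rw [integral_integral_swap (f := fun s x => G (s, x)) hG]
    simp_rw [h2]
    rw [integral_const_mul]
  have hint : Integrable (fun s => ∫ x in arcEvent V p s, f x ∂m)
      (volume : Measure UnitAddCircle) := by
    simp_rw [← h1]; exact hG.integral_prod_left
  have : IsProbabilityMeasure (volume : Measure UnitAddCircle) :=
    ⟨UnitAddCircle.measure_univ⟩
  obtain ⟨s, hs⟩ := exists_integral_le hint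
  refine ⟨s, ?_⟩
  rw [h3] at hs
  rw [ProbabilityTheory.cond, integral_smul_measure, measure_arcEvent hV hT hprod hp1,
    ENNReal.toReal_inv, ENNReal.toReal_ofReal hp0.le, smul_eq_mul, inv_mul_eq_div,
    le_div_iff₀ hp0, mul_comm]
  exact hs

end Arc

/-! ### The Pythagorean inequality -/

/-- Difference between the full increment of `klFun` from `a` to `b` and its rescaled increment
over the proportion `t` of the way. By convexity it is nonnegative for `0 < t ≤ 1`; as `t → 0` it
increases to the Bregman divergence of `klFun` when `0 < a`, and to `+∞` when `a = 0 < b`. -/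
noncomputable def klChordGap (a b t : ℝ) : ℝ :=
  klFun b - klFun a - t⁻¹ * (klFun ((1 - t) * a + t * b) - klFun a)

/-- The Bregman divergence of `klFun`, which is the integrand of the relative entropy of a
distribution of density `b` with respect to one of density `a`. It is meaningful for `0 < a` and for
`a = b = 0`; for `a = 0 < b`, where `Real.log 0 = 0` is a junk value, it is never used. -/
noncomputable def klBregman (a b : ℝ) : ℝ :=
  klFun b - klFun a - (b - a) * Real.log a

theorem klChordGap_nonneg {a b t : ℝ} (ha : 0 ≤ a) (hb : 0 ≤ b) (ht : 0 < t) (ht1 : t ≤ 1) :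
    0 ≤ klChordGap a b t := by
  have h := convexOn_klFun.2 (Set.mem_Ici.2 ha) (Set.mem_Ici.2 hb) (sub_nonneg.2 ht1) ht.le
    (by ring)
  simp only [smul_eq_mul] at h
  have h2 : t⁻¹ * (klFun ((1 - t) * a + t * b) - klFun a) ≤ klFun b - klFun a := by
    rw [inv_mul_le_iff₀ ht]; linarith
  unfold klChordGap; linarith

theorem tendsto_klChordGap {a : ℝ} (ha : 0 < a) (b : ℝ) :
    Filter.Tendsto (klChordGap a b) (nhdsWithin 0 (Set.Ioi 0)) (nhds (klBregman a b)) := by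
  have h1 : HasDerivAt (fun t : ℝ => (1 - t) * a + t * b) (b - a) 0 := by
    have := (((hasDerivAt_id (0 : ℝ)).const_sub 1).mul_const a).add
      ((hasDerivAt_id (0 : ℝ)).mul_const b)
    refine this.congr_deriv (by ring)
  have h2 : HasDerivAt (fun t : ℝ => klFun ((1 - t) * a + t * b)) (Real.log a * (b - a)) 0 := by
    have h3 : HasDerivAt klFun (Real.log a) ((1 - (0 : ℝ)) * a + 0 * b) := by
      simpa using hasDerivAt_klFun ha.ne'
    exact h3.comp (0 : ℝ) h1
  have h4 := h2.tendsto_slope_zero_right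
  simp only [zero_add, smul_eq_mul, sub_zero, one_mul, zero_mul, add_zero] at h4
  have h5 := h4.const_sub (klFun b - klFun a)
  rw [mul_comm] at h5
  exact h5

/-- The slope of `klFun` at `0` is `-∞`, so the gap blows up there: this forces the
absolute continuity with respect to the minimizer. -/
theorem tendsto_klChordGap_zero {b : ℝ} (hb : 0 < b) :
    Filter.Tendsto (klChordGap 0 b) (nhdsWithin 0 (Set.Ioi 0)) Filter.atTop := by
  have h1 : ∀ t ∈ Set.Ioi (0 : ℝ), -(b * Real.log t) = klChordGap 0 b t := by
    intro t ht
    have ht' : t ≠ 0 := ne_of_gt ht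
    simp only [klChordGap, klFun_apply, mul_zero, zero_add, zero_mul, sub_zero]
    rw [Real.log_mul ht' hb.ne']
    field_simp
    ring
  refine Filter.Tendsto.congr' (Filter.eventually_of_mem self_mem_nhdsWithin h1) ?_
  exact Filter.tendsto_neg_atBot_atTop.comp
    ((Real.tendsto_log_nhdsGT_zero).const_mul_atBot hb)

theorem klBregman_mul {a c : ℝ} (ha : 0 ≤ a) (hc : 0 ≤ c) :
    klBregman a (c * a) = a * klFun c := by
  rcases ha.eq_or_lt with rfl | ha
  · simp [klBregman]
  rcases hc.eq_or_lt with rfl | hc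
  · simp [klBregman, klFun_apply]; ring
  simp only [klBregman, klFun_apply, Real.log_mul hc.ne' ha.ne']
  ring

section Pythagoras

variable {E : Type*} [MeasurableSpace E] {m n r : Measure E}

theorem toReal_rnDeriv_mix [IsFiniteMeasure m] [IsFiniteMeasure n] [IsFiniteMeasure r] (s t : ℝ≥0) :
    (fun x => ((s • m + t • n).rnDeriv r x).toReal)
      =ᵐ[r] fun x => s * (m.rnDeriv r x).toReal + t * (n.rnDeriv r x).toReal := by
  filter_upwards [Measure.rnDeriv_add' (s • m) (t • n) r,
    Measure.rnDeriv_smul_left' m r s, Measure.rnDeriv_smul_left' n r t,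
    m.rnDeriv_lt_top r, n.rnDeriv_lt_top r] with x h1 h2 h3 h4 h5
  rw [h1, Pi.add_apply, h2, h3, Pi.smul_apply, Pi.smul_apply, ENNReal.smul_def, ENNReal.smul_def,
    smul_eq_mul, smul_eq_mul,
    ENNReal.toReal_add (ENNReal.mul_ne_top ENNReal.coe_ne_top h4.ne)
      (ENNReal.mul_ne_top ENNReal.coe_ne_top h5.ne), ENNReal.toReal_mul, ENNReal.toReal_mul]
  rfl

/-- If the relative entropy does not decrease when moving from `m` towards `n`, then `m` is an
information projection of `r` as seen from `n`: the Pythagorean inequality holds. -/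
theorem klDiv_add_klDiv_le [IsFiniteMeasure m] [IsFiniteMeasure n] [IsFiniteMeasure r]
    (hmin : ∀ t : ℝ≥0, t ≤ 1 → klDiv m r ≤ klDiv ((1 - t) • m + t • n) r) :
    klDiv n m + klDiv m r ≤ klDiv n r := by
  by_cases hn : klDiv n r = ∞
  · rw [hn]; exact le_top
  have hm : klDiv m r ≠ ∞ := by
    have h := hmin 1 le_rfl
    simp only [tsub_self, zero_smul, one_smul, zero_add] at h
    exact ne_top_of_le_ne_top hn h
  obtain ⟨hnr, hni⟩ := klDiv_ne_top_iff.1 hn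
  obtain ⟨hmr, hmi⟩ := klDiv_ne_top_iff.1 hm
  set a : E → ℝ := fun x => (m.rnDeriv r x).toReal
  set b : E → ℝ := fun x => (n.rnDeriv r x).toReal
  have ham : Measurable a := (Measure.measurable_rnDeriv m r).ennreal_toReal
  have hbm : Measurable b := (Measure.measurable_rnDeriv n r).ennreal_toReal
  have ha0 : ∀ x, 0 ≤ a x := fun x => ENNReal.toReal_nonneg
  have hb0 : ∀ x, 0 ≤ b x := fun x => ENNReal.toReal_nonneg
  have hka : Integrable (fun x => klFun (a x)) r := (integrable_klFun_rnDeriv_iff hmr).2 hmi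
  have hkb : Integrable (fun x => klFun (b x)) r := (integrable_klFun_rnDeriv_iff hnr).2 hni
  have hKa : (klDiv m r).toReal = ∫ x, klFun (a x) ∂r := toReal_klDiv_eq_integral_klFun hmr
  have hKb : (klDiv n r).toReal = ∫ x, klFun (b x) ∂r := toReal_klDiv_eq_integral_klFun hnr
  set K : ℝ := (klDiv n r).toReal - (klDiv m r).toReal with hK
  -- the gaps are integrable, with integrals bounded by the difference of the two entropies
  have hgap : ∀ t : ℝ≥0, 0 < t → t ≤ 1 →
      ∫⁻ x, ENNReal.ofReal (klChordGap (a x) (b x) t) ∂r ≤ ENNReal.ofReal K := by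
    intro t ht ht1
    have htR : (0 : ℝ) < t := ht
    have ht1R : (t : ℝ) ≤ 1 := ht1
    have hmixm : Measurable (fun x => klFun ((1 - (t : ℝ)) * a x + t * b x)) :=
      measurable_klFun.comp ((ham.const_mul _).add (hbm.const_mul _))
    have hmix_nonneg : ∀ x, 0 ≤ (1 - (t : ℝ)) * a x + t * b x := fun x =>
      add_nonneg (mul_nonneg (by linarith) (ha0 x)) (mul_nonneg htR.le (hb0 x))
    have hki : Integrable (fun x => klFun ((1 - (t : ℝ)) * a x + t * b x)) r := by
      refine ((hka.const_mul (1 - (t : ℝ))).add (hkb.const_mul (t : ℝ))).mono'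
        hmixm.aestronglyMeasurable (ae_of_all _ fun x => ?_)
      rw [Real.norm_of_nonneg (klFun_nonneg (hmix_nonneg x))]
      exact convexOn_klFun.2 (Set.mem_Ici.2 (ha0 x)) (Set.mem_Ici.2 (hb0 x))
        (by linarith) htR.le (by ring)
    have hac : (1 - t) • m + t • n ≪ r :=
      Measure.AbsolutelyContinuous.add_left (hmr.smul_left _) (hnr.smul_left _)
    have hdens : (fun x => klFun ((((1 - t) • m + t • n).rnDeriv r x).toReal))
        =ᵐ[r] fun x => klFun ((1 - (t : ℝ)) * a x + t * b x) := by
      filter_upwards [toReal_rnDeriv_mix (m := m) (n := n) (r := r) (1 - t) t] with x hx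
      rw [hx, NNReal.coe_sub ht1, NNReal.coe_one]
    have hKt : (klDiv ((1 - t) • m + t • n) r).toReal
        = ∫ x, klFun ((1 - (t : ℝ)) * a x + t * b x) ∂r := by
      rw [toReal_klDiv_eq_integral_klFun hac]; exact integral_congr_ae hdens
    have hfin : klDiv ((1 - t) • m + t • n) r ≠ ∞ := by
      refine klDiv_ne_top_iff.2 ⟨hac, (integrable_klFun_rnDeriv_iff hac).1 ?_⟩
      exact (integrable_congr hdens).2 hki
    have hle : (klDiv m r).toReal ≤ (klDiv ((1 - t) • m + t • n) r).toReal :=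
      ENNReal.toReal_mono hfin (hmin t ht1)
    have hgi : Integrable (fun x => klChordGap (a x) (b x) t) r :=
      (hkb.sub hka).sub ((hki.sub hka).const_mul _)
    rw [← ofReal_integral_eq_lintegral_ofReal hgi
      (ae_of_all _ fun x => klChordGap_nonneg (ha0 x) (hb0 x) htR ht1R)]
    refine ENNReal.ofReal_le_ofReal ?_
    have : ∫ x, klChordGap (a x) (b x) t ∂r
        = K - (t : ℝ)⁻¹ * ((klDiv ((1 - t) • m + t • n) r).toReal - (klDiv m r).toReal) := by
      rw [hK, hKa, hKb, hKt, ← integral_sub hkb hka, ← integral_sub hki hka,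
        ← integral_const_mul]
      exact integral_sub (hkb.sub hka) ((hki.sub hka).const_mul _)
    rw [this]
    have := mul_nonneg (inv_nonneg.2 htR.le) (sub_nonneg.2 hle)
    linarith
  let τ : ℕ → ℝ≥0 := fun k => ((k : ℝ≥0) + 1)⁻¹
  have hτ0 : ∀ k, 0 < τ k := fun k => by positivity
  have hτ1 : ∀ k, τ k ≤ 1 := fun k => inv_le_one_of_one_le₀ (by simp)
  have hτ : Filter.Tendsto (fun k => ((τ k : ℝ≥0) : ℝ)) Filter.atTop
      (nhdsWithin 0 (Set.Ioi 0)) := by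
    refine tendsto_nhdsWithin_iff.2 ⟨?_, Filter.Eventually.of_forall fun k => hτ0 k⟩
    simpa [τ, one_div] using (tendsto_one_div_add_atTop_nhds_zero_nat (𝕜 := ℝ))
  have hgm : ∀ k, Measurable (fun x => ENNReal.ofReal (klChordGap (a x) (b x) (τ k))) := by
    intro k
    refine Measurable.ennreal_ofReal ?_
    exact ((measurable_klFun.comp hbm).sub (measurable_klFun.comp ham)).sub
      (((measurable_klFun.comp ((ham.const_mul _).add (hbm.const_mul _))).sub
        (measurable_klFun.comp ham)).const_mul _)
  have hfatou : ∫⁻ x, Filter.liminf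
      (fun k => ENNReal.ofReal (klChordGap (a x) (b x) (τ k))) Filter.atTop ∂r
      ≤ ENNReal.ofReal K := by
    refine (lintegral_liminf_le hgm).trans ?_
    refine (Filter.liminf_le_liminf
      (Filter.Eventually.of_forall fun k => hgap (τ k) (hτ0 k) (hτ1 k))).trans ?_
    exact Filter.liminf_const _ |>.le
  -- where `a` vanishes the gaps tend to infinity unless `b` vanishes too
  have hab : ∀ᵐ x ∂r, a x = 0 → b x = 0 := by
    have hlt := ae_lt_top (Measurable.liminf hgm)
      (ne_top_of_le_ne_top ENNReal.ofReal_ne_top hfatou)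
    filter_upwards [hlt] with x hx hax
    by_contra hbx
    have hlim := ENNReal.tendsto_ofReal_atTop.comp
      ((tendsto_klChordGap_zero ((hb0 x).lt_of_ne' hbx)).comp hτ)
    rw [← hax] at hlim
    exact hx.ne hlim.liminf_eq
  have hnm : n ≪ m := by
    refine Measure.AbsolutelyContinuous.mk fun s hs hms => ?_
    rw [← Measure.setLIntegral_rnDeriv hmr, setLIntegral_eq_zero_iff hs
      (Measure.measurable_rnDeriv m r)] at hms
    rw [← Measure.setLIntegral_rnDeriv hnr, setLIntegral_eq_zero_iff hs
      (Measure.measurable_rnDeriv n r)]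
    filter_upwards [hms, hab, n.rnDeriv_lt_top r] with x h1 h2 h3 hxs
    have h4 : b x = 0 := h2 (by simp [a, h1 hxs])
    exact ((ENNReal.toReal_eq_zero_iff _).1 h4).resolve_right h3.ne
  have hnm_kl : klDiv n m ≤ ENNReal.ofReal K := by
    refine le_trans (le_of_eq ?_) hfatou
    rw [klDiv_eq_lintegral_klFun_of_ac hnm, ← lintegral_rnDeriv_mul hmr
      (f := fun x => ENNReal.ofReal (klFun (n.rnDeriv m x).toReal)) (measurable_klFun.comp
        (Measure.measurable_rnDeriv n m).ennreal_toReal).ennreal_ofReal.aemeasurable]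
    refine lintegral_congr_ae ?_
    filter_upwards [hab, Measure.rnDeriv_mul_rnDeriv (κ := r) hnm, m.rnDeriv_lt_top r]
      with x h1 h2 h3
    have hbx : b x = (n.rnDeriv m x).toReal * a x := by
      simp only [b, a]; rw [← h2, Pi.mul_apply, ENNReal.toReal_mul]
    have hlim : Filter.Tendsto (fun k => klChordGap (a x) (b x) (τ k)) Filter.atTop
        (nhds (klBregman (a x) (b x))) := by
      rcases (ha0 x).eq_or_lt with h0 | h0
      · have hb' := h1 h0.symm
        rw [← h0, hb']
        simp [klChordGap, klBregman]
      · exact (tendsto_klChordGap h0 (b x)).comp hτ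
    have hlim' := (ENNReal.continuous_ofReal.tendsto (klBregman (a x) (b x))).comp hlim
    rw [show (fun k => ENNReal.ofReal (klChordGap (a x) (b x) (τ k)))
      = ENNReal.ofReal ∘ fun k => klChordGap (a x) (b x) (τ k) from rfl, hlim'.liminf_eq]
    rw [hbx, klBregman_mul (ha0 x) ENNReal.toReal_nonneg, ENNReal.ofReal_mul (ha0 x)]
    simp only [a]; rw [ENNReal.ofReal_toReal h3.ne]
  calc klDiv n m + klDiv m r ≤ ENNReal.ofReal K + klDiv m r := by gcongr
    _ = ENNReal.ofReal K + ENNReal.ofReal (klDiv m r).toReal := by rw [ENNReal.ofReal_toReal hm]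
    _ = klDiv n r := by
      rw [← ENNReal.ofReal_add _ ENNReal.toReal_nonneg, hK, sub_add_cancel,
        ENNReal.ofReal_toReal hn]
      have h := hmin 1 le_rfl
      simp only [tsub_self, zero_smul, one_smul, zero_add] at h
      exact sub_nonneg.2 (ENNReal.toReal_mono hn h)

end Pythagoras

section ConvexClass

variable {E F : Type*} [MeasurableSpace E] [MeasurableSpace F]

theorem ConvexClass.pullbackClass {T : E → F} (hT : Measurable T)
    {CT : Set (ProbabilityMeasure F)} (hCT : ConvexClass CT) :
    ConvexClass (pullbackClass T hT CT) := by
  rintro _ ⟨μ, hμ, rfl⟩ _ ⟨η, hη, rfl⟩ s t hs ht hst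
  have hmap : ((s • (μ : Measure E) + t • (η : Measure E)).map T)
      = s • (μ : Measure E).map T + t • (η : Measure E).map T := by
    rw [Measure.map_add _ _ hT, Measure.map_smul, Measure.map_smul]
  have hprob : IsProbabilityMeasure (s • (μ : Measure E) + t • (η : Measure E)) :=
    ⟨by
      simp only [Measure.add_apply, Measure.smul_apply, measure_univ, ENNReal.smul_def,
        smul_eq_mul, mul_one]
      exact_mod_cast hst⟩
  obtain ⟨ν, hν, hνeq⟩ := hCT ⟨_, hμ, rfl⟩ ⟨_, hη, rfl⟩ hs ht hst
  let ρ : ProbabilityMeasure E := ⟨s • (μ : Measure E) + t • (η : Measure E), hprob⟩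
  have hρ : ρ.map hT.aemeasurable = ν := Subtype.ext (hmap.trans hνeq.symm)
  refine ⟨ρ, ?_, rfl⟩
  change ρ.map hT.aemeasurable ∈ CT
  rw [hρ]; exact hν

theorem relEnt_le_relEnt_iff {η μ : ProbabilityMeasure E} {η' μ' : ProbabilityMeasure F} :
    relEnt η μ ≤ relEnt η' μ' ↔
      klDiv (η : Measure E) (μ : Measure E) ≤ klDiv (η' : Measure F) (μ' : Measure F) :=
  EReal.coe_ennreal_le_coe_ennreal_iff

/-- Pythagorean inequality for the entropy minimizer over a convex class. -/
theorem IsEntropyMinimizer.klDiv_add_klDiv_le {π μ η : ProbabilityMeasure E}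
    {C : Set (ProbabilityMeasure E)} (hC : ConvexClass C) (hμ : IsEntropyMinimizer π C μ)
    (hη : η ∈ C) :
    klDiv (η : Measure E) (μ : Measure E) + klDiv (μ : Measure E) (π : Measure E)
      ≤ klDiv (η : Measure E) (π : Measure E) := by
  refine _root_.klDiv_add_klDiv_le fun t ht => ?_
  obtain ⟨ν, hν, hνeq⟩ := hC ⟨_, hμ.1, rfl⟩ ⟨_, hη, rfl⟩ (zero_le (a := 1 - t))
    (zero_le (a := t)) (tsub_add_cancel_of_le ht)
  have := relEnt_le_relEnt_iff.1 (hμ.2 ν hν)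
  simp only at hνeq
  rwa [hνeq] at this

end ConvexClass

/-! ### Structure of the minimizer -/

section Minimizer

variable {E F : Type*} [MeasurableSpace E] [StandardBorelSpace E] [MeasurableSpace F]
  {T : E → F}

/-- A distribution disintegrated along `T` with a prescribed conditional law, that is, with the law
of `(T, id)` equal to `T#μ ⊗ κ` where `κ` is the conditional law of `π` given `T`, has a density
with respect to `π` which is a function of `T`. -/
theorem eq_withDensity_of_map_prodMk [Nonempty E] {μ π : Measure E} [IsFiniteMeasure μ]
    [IsFiniteMeasure π] (hT : Measurable T) (hac : μ ≪ π)
    (h : μ.map (fun x => (T x, x)) = (μ.map T) ⊗ₘ condDistrib (id : E → E) T π) :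
    μ = π.withDensity (fun x => (μ.map T).rnDeriv (π.map T) (T x)) := by
  have hπ : (π.map T) ⊗ₘ condDistrib (id : E → E) T π = π.map (fun x => (T x, x)) :=
    compProd_map_condDistrib aemeasurable_id
  have hTi : Measurable (fun x => (T x, x)) := hT.prodMk measurable_id
  have hgm : Measurable ((μ.map T).rnDeriv (π.map T)) := Measure.measurable_rnDeriv _ _
  ext S hS
  have hκ : Measurable fun t => condDistrib (id : E → E) T π t S :=
    Kernel.measurable_coe _ hS
  have hind : Measurable (S.indicator (1 : E → ℝ≥0∞)) := measurable_one.indicator hS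
  have hprodm : Measurable fun q : F × E =>
      (μ.map T).rnDeriv (π.map T) q.1 * S.indicator (1 : E → ℝ≥0∞) q.2 :=
    (hgm.comp measurable_fst).mul (hind.comp measurable_snd)
  calc μ S = μ.map (fun x => (T x, x)) (Set.univ ×ˢ S) := by
        rw [Measure.map_apply hTi (MeasurableSet.univ.prod hS)]; congr 1; ext; simp
    _ = ∫⁻ t, condDistrib (id : E → E) T π t S ∂(μ.map T) := by
        rw [h, Measure.compProd_apply (MeasurableSet.univ.prod hS)]
        refine lintegral_congr fun t => ?_
        congr 1; ext; simp
    _ = ∫⁻ t, (μ.map T).rnDeriv (π.map T) t * condDistrib (id : E → E) T π t S ∂(π.map T) :=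
        (lintegral_rnDeriv_mul (hac.map hT) hκ.aemeasurable).symm
    _ = ∫⁻ q, (μ.map T).rnDeriv (π.map T) q.1 * S.indicator 1 q.2
          ∂((π.map T) ⊗ₘ condDistrib (id : E → E) T π) := by
        rw [Measure.lintegral_compProd hprodm]
        refine lintegral_congr fun t => ?_
        dsimp only
        rw [lintegral_const_mul _ hind, lintegral_indicator_one hS]
    _ = ∫⁻ x, (μ.map T).rnDeriv (π.map T) (T x) * S.indicator 1 x ∂π := by
        rw [hπ, lintegral_map hprodm hTi]
    _ = π.withDensity (fun x => (μ.map T).rnDeriv (π.map T) (T x)) S := by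
        rw [withDensity_apply _ hS, ← lintegral_indicator hS]
        refine lintegral_congr fun x => ?_
        by_cases hx : x ∈ S <;> simp [hx]

/-- The entropy minimizer over a class defined by the law of `T` has the same conditional law given
`T` as the reference `π`. Indeed, substituting this conditional law preserves the law of `T` and, by
data processing, does not increase the entropy, while the minimizer is unique by the Pythagorean
inequality. -/
theorem IsEntropyMinimizer.map_prodMk [Nonempty E] [StandardBorelSpace F]
    {π μ : ProbabilityMeasure E} (hT : Measurable T) {CT : Set (ProbabilityMeasure F)}
    (hCT : ConvexClass CT)
    (hμ : IsEntropyMinimizer π (pullbackClass T hT CT) μ)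
    (hfin : klDiv (μ : Measure E) (π : Measure E) ≠ ∞) :
    (μ : Measure E).map (fun x => (T x, x))
      = ((μ : Measure E).map T) ⊗ₘ condDistrib (id : E → E) T (π : Measure E) := by
  have hac : (μ : Measure E) ≪ (π : Measure E) := (klDiv_ne_top_iff.1 hfin).1
  have hTi : Measurable (fun x => (T x, x)) := hT.prodMk measurable_id
  have hTs : Measurable (fun q : F × E => T q.2) := hT.comp measurable_snd
  have hπ : ((π : Measure E).map T) ⊗ₘ condDistrib (id : E → E) T (π : Measure E)
      = (π : Measure E).map (fun x => (T x, x)) := compProd_map_condDistrib aemeasurable_id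
  have hPF : IsProbabilityMeasure ((μ : Measure E).map T) :=
    Measure.isProbabilityMeasure_map hT.aemeasurable
  set P := ((μ : Measure E).map T) ⊗ₘ condDistrib (id : E → E) T (π : Measure E)
  have hgraph : ∀ᵐ q ∂P, T q.2 = q.1 := by
    have hPac : P ≪ (π : Measure E).map (fun x => (T x, x)) := by
      rw [← hπ]; exact (hac.map hT).compProd_left _
    refine hPac.ae_le ((ae_map_iff hTi.aemeasurable
      (measurableSet_eq_fun hTs measurable_fst)).2 (ae_of_all _ fun x => rfl))
  have hprob : IsProbabilityMeasure (P.map Prod.snd) :=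
    Measure.isProbabilityMeasure_map measurable_snd.aemeasurable
  have hPT : (P.map Prod.snd).map T = (μ : Measure E).map T := by
    rw [Measure.map_map hT measurable_snd, ← Measure.fst_compProd ((μ : Measure E).map T)
      (condDistrib (id : E → E) T (π : Measure E))]
    exact Measure.map_congr hgraph
  let ρ : ProbabilityMeasure E := ⟨P.map Prod.snd, hprob⟩
  have hρ : ρ ∈ pullbackClass T hT CT := by
    have : ρ.map hT.aemeasurable = μ.map hT.aemeasurable := Subtype.ext hPT
    change ρ.map hT.aemeasurable ∈ CT
    rw [this]; exact hμ.1
  have hle : klDiv (P.map Prod.snd) (π : Measure E) ≤ klDiv (μ : Measure E) (π : Measure E) := by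
    have hπs : ((π : Measure E).map (fun x => (T x, x))).map Prod.snd = (π : Measure E) := by
      rw [Measure.map_map measurable_snd hTi]; exact Measure.map_id
    calc klDiv (P.map Prod.snd) (π : Measure E)
        = klDiv (P.map Prod.snd)
            ((((π : Measure E).map T) ⊗ₘ condDistrib (id : E → E) T (π : Measure E)).map
              Prod.snd) := by rw [hπ, hπs]
      _ ≤ klDiv P (((π : Measure E).map T) ⊗ₘ condDistrib (id : E → E) T (π : Measure E)) :=
          klDiv_map_le _ _ measurable_snd
      _ = klDiv ((μ : Measure E).map T) ((π : Measure E).map T) := klDiv_compProd_left _ _ _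
      _ ≤ _ := klDiv_map_le _ _ hT
  have hpyth := (hμ.klDiv_add_klDiv_le (hCT.pullbackClass hT) hρ).trans hle
  have hzero : klDiv (P.map Prod.snd) (μ : Measure E) = 0 := by
    by_contra hne
    exact absurd hpyth (not_le.2 (by
      rw [add_comm]; exact ENNReal.lt_add_right hfin hne))
  have heq : P.map Prod.snd = (μ : Measure E) := klDiv_eq_zero_iff.1 hzero
  calc (μ : Measure E).map (fun x => (T x, x))
      = (P.map Prod.snd).map (fun x => (T x, x)) := by rw [heq]
    _ = P.map (fun q => (T q.2, q.2)) := Measure.map_map hTi measurable_snd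
    _ = P.map id := Measure.map_congr (hgraph.mono fun q hq => Prod.ext hq rfl)
    _ = P := Measure.map_id

/-- When the conditional laws given `T` are atomless, there is a uniform variable independent
of `T`. -/
theorem exists_uniform_map_prodMk {μ : Measure E} [IsFiniteMeasure μ] (hT : Measurable T)
    {κ : Kernel F E} [IsMarkovKernel κ] (h : μ.map (fun x => (T x, x)) = (μ.map T) ⊗ₘ κ)
    (hκ : ∀ᵐ t ∂(μ.map T), ∀ x, κ t {x} = 0) :
    ∃ V : E → UnitAddCircle, Measurable V ∧
      μ.map (fun x => (T x, V x)) = (μ.map T).prod volume := by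
  obtain ⟨u, hu, huκ⟩ := exists_uniform_of_atomless_kernel κ
  have hTi : Measurable (fun x => (T x, x)) := hT.prodMk measurable_id
  refine ⟨fun x => u (T x, x), hu.comp hTi, ?_⟩
  have hmap : μ.map (fun x => (T x, u (T x, x)))
      = ((μ.map T) ⊗ₘ κ).map (fun q => (q.1, u q)) := by
    rw [← h, Measure.map_map (measurable_fst.prodMk hu) hTi]; rfl
  rw [hmap]
  symm
  refine Measure.prod_eq fun C D hC hD => ?_
  rw [Measure.map_apply (measurable_fst.prodMk hu) (hC.prod hD),
    Measure.compProd_apply ((measurable_fst.prodMk hu) (hC.prod hD)), mul_comm,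
    ← lintegral_indicator_const hC]
  refine lintegral_congr_ae ?_
  filter_upwards [hκ] with t ht
  by_cases htC : t ∈ C
  · rw [Set.indicator_of_mem htC, ← huκ t ht,
      Measure.map_apply (show Measurable fun x => u (t, x) from hu.comp measurable_prodMk_left) hD]
    congr 1; ext x; simp [htC]
  · rw [Set.indicator_of_notMem htC]
    convert measure_empty (μ := κ t)
    ext x; simp [htC]

end Minimizer

/-! ### Entropy of conditioned distributions -/

section Conditioned

variable {E F : Type*} [MeasurableSpace E] [MeasurableSpace F]

/-- If `dm/dr` is a function of `T`, the mean of `log (dm/dr)` is the same under `m` and under any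
`n ≪ m` giving the same law to `T`. -/
theorem integral_llr_eq_of_map_eq {T : E → F} {m n r : Measure E}
    [IsFiniteMeasure m] [IsFiniteMeasure r] (hT : Measurable T)
    {g : F → ℝ≥0∞} (hg : Measurable g) (hm : m = r.withDensity (fun x => g (T x)))
    (hnm : n ≪ m) (hmap : n.map T = m.map T) (hint : Integrable (llr m r) m) :
    Integrable (llr m r) n ∧ ∫ x, llr m r x ∂n = ∫ x, llr m r x ∂m := by
  have hmr : m ≪ r := hm ▸ withDensity_absolutelyContinuous _ _
  set G : F → ℝ := fun t => Real.log (g t).toReal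
  have hGm : Measurable G := hg.ennreal_toReal.log
  have hllr : llr m r =ᵐ[m] G ∘ T := by
    have h1 : m.rnDeriv r =ᵐ[r] fun x => g (T x) := by
      conv_lhs => rw [hm]
      exact Measure.rnDeriv_withDensity r (hg.comp hT)
    filter_upwards [hmr.ae_le h1] with x hx
    simp only [llr, hx, G, Function.comp]
  have hllrn : llr m r =ᵐ[n] G ∘ T := hnm.ae_le hllr
  rw [integrable_congr hllrn, integral_congr_ae hllrn, integral_congr_ae hllr]
  rw [integrable_congr hllr, ← integrable_map_measure hGm.aestronglyMeasurable hT.aemeasurable,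
    ← hmap, integrable_map_measure hGm.aestronglyMeasurable hT.aemeasurable] at hint
  refine ⟨hint, ?_⟩
  simp only [Function.comp]
  rw [← integral_map hT.aemeasurable hGm.aestronglyMeasurable,
    ← integral_map hT.aemeasurable hGm.aestronglyMeasurable, hmap]

variable {m r : Measure E} [IsProbabilityMeasure m] {B : Set E}

/-- Conditioning on `B` multiplies the density by the constant `1 / m B` on `B`. -/
theorem llr_cond [SigmaFinite r] (hmr : m ≪ r) (hB : MeasurableSet B) (hB0 : m B ≠ 0) :
    llr (cond m B) r =ᵐ[cond m B] fun x => llr m r x - Real.log (m B).toReal := by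
  have hac : m.restrict B ≪ r := Measure.restrict_le_self.absolutelyContinuous.trans hmr
  have h1 := llr_smul_left hac (m B)⁻¹ (by simp) (by simpa using hB0)
  have h2 : ∀ᵐ x ∂(m.restrict B), llr (m.restrict B) r x = llr m r x := by
    filter_upwards [hac.ae_le (Measure.rnDeriv_restrict m r hB), ae_restrict_mem hB] with x hx hxB
    rw [llr, llr, hx, Set.indicator_of_mem hxB]
  have h3 : llr (cond m B) r =ᵐ[m.restrict B] fun x => llr m r x - Real.log (m B).toReal := by
    filter_upwards [h1, h2] with x hx1 hx2
    rw [ProbabilityTheory.cond, hx1, hx2, ENNReal.toReal_inv, Real.log_inv, sub_eq_add_neg]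
  exact (Measure.smul_absolutelyContinuous (c := (m B)⁻¹)).ae_le h3

theorem integrable_cond_iff (hB0 : m B ≠ 0) {f : E → ℝ} :
    Integrable f (cond m B) ↔ IntegrableOn f B m :=
  integrable_smul_measure (by simp) (by simpa using hB0)

theorem klDiv_cond_ne_top_iff [SigmaFinite r] (hmr : m ≪ r) (hB : MeasurableSet B)
    (hB0 : m B ≠ 0) : klDiv (cond m B) r ≠ ∞ ↔ IntegrableOn (llr m r) B m := by
  have := cond_isProbabilityMeasure hB0
  rw [klDiv_ne_top_iff, and_iff_right (cond_absolutelyContinuous.trans hmr),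
    integrable_congr (llr_cond hmr hB hB0), ← integrable_cond_iff hB0]
  refine ⟨fun h => ?_, fun h => h.sub (integrable_const _)⟩
  exact (h.add (integrable_const (Real.log (m B).toReal))).congr
    (ae_of_all _ fun x => sub_add_cancel _ _)

theorem toReal_klDiv_cond [IsProbabilityMeasure r] (hmr : m ≪ r) (hB : MeasurableSet B)
    (hB0 : m B ≠ 0) (hint : IntegrableOn (llr m r) B m) :
    (klDiv (cond m B) r).toReal = ∫ x, llr m r x ∂(cond m B) - Real.log (m B).toReal := by
  have := cond_isProbabilityMeasure hB0
  rw [toReal_klDiv_of_measure_eq (cond_absolutelyContinuous.trans hmr) (by simp),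
    integral_congr_ae (llr_cond hmr hB hB0),
    integral_sub ((integrable_cond_iff hB0).2 hint) (integrable_const _)]
  simp

/-- If finitely many events cover the space and conditioning on each of them gives a finite
relative entropy, then the relative entropy is finite. -/
theorem klDiv_ne_top_of_cond [IsFiniteMeasure r] {ι : Type*} (S : Finset ι) {B : ι → Set E}
    (hB : ∀ i ∈ S, MeasurableSet (B i)) (hB0 : ∀ i ∈ S, m (B i) ≠ 0)
    (hcover : ⋃ i ∈ S, B i = Set.univ) (hfin : ∀ i ∈ S, klDiv (cond m (B i)) r ≠ ∞) :
    klDiv m r ≠ ∞ := by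
  have hmr : m ≪ r := by
    refine Measure.AbsolutelyContinuous.mk fun s hs hrs => ?_
    have h1 : s ⊆ ⋃ i ∈ S, (B i ∩ s) := fun x hx => by
      have : x ∈ ⋃ i ∈ S, B i := hcover ▸ Set.mem_univ x
      simpa [hx] using this
    refine measure_mono_null h1 ((measure_biUnion_null_iff S.countable_toSet).2 fun i hi => ?_)
    have h2 := (klDiv_ne_top_iff.1 (hfin i hi)).1 hrs
    rw [cond_apply (hB i hi), mul_eq_zero] at h2
    exact h2.resolve_left (by simp)
  refine klDiv_ne_top_iff.2 ⟨hmr, ?_⟩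
  rw [← integrableOn_univ, ← hcover, integrableOn_finset_iUnion]
  exact fun i hi => (klDiv_cond_ne_top_iff hmr (hB i hi) (hB0 i hi)).1 (hfin i hi)

end Conditioned

/-! ### The worst-case log-cost -/

theorem relEnt_eq_coe_toReal {E : Type*} [MeasurableSpace E] {η μ : ProbabilityMeasure E}
    (h : klDiv (η : Measure E) (μ : Measure E) ≠ ∞) :
    relEnt η μ = ((klDiv (η : Measure E) (μ : Measure E)).toReal : EReal) :=
  (EReal.coe_ennreal_toReal h).symm

/-- For every level `h` above the minimal entropy there is a family of events, with a common
probability `p` under the minimizer, such that conditioning the minimizer on any of them gives a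
distribution of the class of entropy exactly `h`. Finitely many of them cover the space, and
one of them does not decrease the mean of a given integrable function. -/
theorem exists_cond_family {E F : Type*} [MeasurableSpace E] [StandardBorelSpace E] [Nonempty E]
    [MeasurableSpace F] [StandardBorelSpace F]
    (π : ProbabilityMeasure E) (T : E → F) (hT : Measurable T)
    (CT : Set (ProbabilityMeasure F)) (hCT : ConvexClass CT)
    (μs : ProbabilityMeasure E) (hμs : IsEntropyMinimizer π (pullbackClass T hT CT) μs)
    (hatomless : ∀ᵐ t ∂((π : Measure E).map T),
      ∀ x : E, condDistrib (id : E → E) T (π : Measure E) t {x} = 0)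
    (hfin : klDiv (μs : Measure E) (π : Measure E) ≠ ∞)
    (h : ℝ) (hh : (klDiv (μs : Measure E) (π : Measure E)).toReal ≤ h) :
    ∃ (B : UnitAddCircle → Set E) (η : UnitAddCircle → ProbabilityMeasure E),
      (∀ s, MeasurableSet (B s)) ∧
      (∀ s, (μs : Measure E) (B s) = ENNReal.ofReal
        (Real.exp ((klDiv (μs : Measure E) (π : Measure E)).toReal - h))) ∧
      (∀ s, (η s : Measure E) = cond (μs : Measure E) (B s)) ∧
      (∀ s, η s ∈ pullbackClass T hT CT) ∧
      (∀ s, relEnt (η s) π = (h : EReal)) ∧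
      (∃ S : Finset UnitAddCircle, ⋃ s ∈ S, B s = Set.univ) ∧
      (∀ f : E → ℝ, Integrable f (μs : Measure E) →
        ∃ s, ∫ x, f x ∂(μs : Measure E) ≤ ∫ x, f x ∂(η s : Measure E)) := by
  obtain ⟨hac, hint⟩ := klDiv_ne_top_iff.1 hfin
  set k := (klDiv (μs : Measure E) (π : Measure E)).toReal with hk
  have hdis := hμs.map_prodMk hT hCT hfin
  obtain ⟨V, hV, hprod⟩ := exists_uniform_map_prodMk hT hdis ((hac.map hT).ae_le hatomless)
  -- this value of `p` makes the entropy `k - log p` of the conditioned distributions equal to `h`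
  set p := Real.exp (k - h) with hp
  have hp0 : 0 < p := Real.exp_pos _
  have hp1 : p ≤ 1 := Real.exp_le_one_iff.2 (by linarith)
  have hB := fun s => measurableSet_arcEvent (p := p) hV s
  have hBp : ∀ s, (μs : Measure E) (arcEvent V p s) = ENNReal.ofReal p := fun s =>
    measure_arcEvent hV hT hprod hp1 s
  have hB0 : ∀ s, (μs : Measure E) (arcEvent V p s) ≠ 0 := fun s => by
    rw [hBp]; simpa using hp0
  let η : UnitAddCircle → ProbabilityMeasure E := fun s =>
    ⟨cond (μs : Measure E) (arcEvent V p s), cond_isProbabilityMeasure (hB0 s)⟩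
  have hmap : ∀ s, (cond (μs : Measure E) (arcEvent V p s)).map T = (μs : Measure E).map T :=
    fun s => map_cond_arcEvent hV hT hprod hp0 hp1 s
  refine ⟨arcEvent V p, η, hB, hBp, fun s => rfl, fun s => ?_, fun s => ?_,
    exists_finset_iUnion_arcEvent V hp0, fun f hf =>
      exists_integral_le_integral_cond_arcEvent hV hT hprod hp0 hp1 hf⟩
  · have : (η s).map hT.aemeasurable = μs.map hT.aemeasurable := Subtype.ext (hmap s)
    change (η s).map hT.aemeasurable ∈ CT
    rw [this]; exact hμs.1
  · have hfin' : klDiv (η s : Measure E) (π : Measure E) ≠ ∞ :=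
      (klDiv_cond_ne_top_iff hac (hB s) (hB0 s)).2 hint.integrableOn
    rw [relEnt_eq_coe_toReal hfin']
    change (((klDiv (cond (μs : Measure E) (arcEvent V p s)) (π : Measure E)).toReal : ℝ) : EReal)
      = _
    rw [toReal_klDiv_cond hac (hB s) (hB0 s) hint.integrableOn,
      (integral_llr_eq_of_map_eq hT (Measure.measurable_rnDeriv _ _)
        (eq_withDensity_of_map_prodMk hT hac hdis) cond_absolutelyContinuous (hmap s) hint).2,
      ← toReal_klDiv_of_measure_eq hac (by simp), ← hk, hBp, ENNReal.toReal_ofReal hp0.le, hp,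
      Real.log_exp]
    congr 1; ring

theorem theorem2 {E F : Type*} [MeasurableSpace E] [StandardBorelSpace E] [Nonempty E]
    [MeasurableSpace F] [StandardBorelSpace F]
    (π : ProbabilityMeasure E) (T : E → F) (hT : Measurable T)
    (CT : Set (ProbabilityMeasure F)) (hCT : ConvexClass CT)
    (A : Set (ProbabilityMeasure E)) (hA : A ⊆ pullbackClass T hT CT)
    (μs : ProbabilityMeasure E) (hμs : IsEntropyMinimizer π (pullbackClass T hT CT) μs)
    (hatomless : ∀ᵐ t ∂((π : Measure E).map T),
      ∀ x : E, condDistrib (id : E → E) T (π : Measure E) t {x} = 0)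
    (hind : ∀ η ∈ pullbackClass T hT CT, HasIndicatorDensity η μs → η ∈ A)
    (h : ℝ) (hh : relEnt μs π ≤ (h : EReal)) :
    (∀ f : E → ℝ, Measurable f → (∃ M : ℝ, ∀ x, |f x| ≤ M) →
      ∃ η ∈ A, relEnt η π = (h : EReal) ∧
        ∫ x, f x ∂(μs : Measure E) ≤ ∫ x, f x ∂(η : Measure E)) ∧
    WLC A h μs π = - relEnt μs π ∧
    (∀ μ : ProbabilityMeasure E, WLC A h μs π + relEnt μs μ ≤ WLC A h μ π) ∧
    (∀ μ : ProbabilityMeasure E, μ ≠ μs → WLC A h μs π < WLC A h μ π) := by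
  have hfin : klDiv (μs : Measure E) (π : Measure E) ≠ ∞ := by
    intro htop
    rw [relEnt, htop, EReal.coe_ennreal_top] at hh
    exact EReal.coe_ne_top h (top_le_iff.1 hh)
  have hk := relEnt_eq_coe_toReal hfin
  rw [hk, EReal.coe_le_coe_iff] at hh
  obtain ⟨B, η, hB, hBp, hηB, hηC, hηh, ⟨S, hS⟩, hηf⟩ :=
    exists_cond_family π T hT CT hCT μs hμs hatomless hfin h hh
  set k := (klDiv (μs : Measure E) (π : Measure E)).toReal with hkdef
  have hηA : ∀ s, η s ∈ A := fun s => hind _ (hηC s) ⟨B s, hB s, hηB s⟩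
  have hB0 : ∀ s, (μs : Measure E) (B s) ≠ 0 := fun s => by
    rw [hBp]; simpa using Real.exp_pos _
  have hlog : ∀ s, Real.log ((μs : Measure E) (B s)).toReal = k - h := fun s => by
    rw [hBp, ENNReal.toReal_ofReal (Real.exp_pos _).le, Real.log_exp]
  have hsup : ∀ (μ : ProbabilityMeasure E) (s : UnitAddCircle),
      relEnt (η s) μ - (h : EReal) ≤ WLC A h μ π := fun μ s =>
    EReal.sub_le_sub (le_iSup₂_of_le (η s) ⟨hηA s, (hηh s).le⟩ le_rfl) le_rfl
  -- the upper bound comes from the Pythagorean inequality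
  have hupper : WLC A h μs π ≤ ((-k : ℝ) : EReal) := by
    have hbound : (⨆ ν ∈ {ν : ProbabilityMeasure E | ν ∈ A ∧ relEnt ν π ≤ (h : EReal)},
        relEnt ν μs) ≤ ((h - k : ℝ) : EReal) := by
      refine iSup₂_le fun ν hν => ?_
      have hpyth := hμs.klDiv_add_klDiv_le (hCT.pullbackClass hT) (hA hν.1)
      have hνfin : klDiv (ν : Measure E) (π : Measure E) ≠ ∞ := by
        intro htop
        have := hν.2
        rw [relEnt, htop, EReal.coe_ennreal_top] at this
        exact EReal.coe_ne_top h (top_le_iff.1 this)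
      have hνfin' : klDiv (ν : Measure E) (μs : Measure E) ≠ ∞ :=
        ne_top_of_le_ne_top hνfin (le_self_add.trans hpyth)
      have h1 := ENNReal.toReal_mono hνfin hpyth
      rw [ENNReal.toReal_add hνfin' hfin] at h1
      have h2 := hν.2
      rw [relEnt_eq_coe_toReal hνfin, EReal.coe_le_coe_iff] at h2
      rw [relEnt_eq_coe_toReal hνfin', EReal.coe_le_coe_iff]
      linarith
    calc WLC A h μs π ≤ ((h - k : ℝ) : EReal) - (h : EReal) := EReal.sub_le_sub hbound le_rfl
      _ = ((-k : ℝ) : EReal) := by rw [← EReal.coe_sub]; congr 1; ring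
  -- the lower bound, for an arbitrary sampling distribution
  have hlower : ∀ μ : ProbabilityMeasure E,
      ((-k : ℝ) : EReal) + relEnt μs μ ≤ WLC A h μ π := by
    intro μ
    by_cases hμ : klDiv (μs : Measure E) (μ : Measure E) = ∞
    · -- one of the events of a finite cover already has infinite cost
      have hex : ∃ s, klDiv (η s : Measure E) (μ : Measure E) = ∞ := by
        by_contra! hne
        exact klDiv_ne_top_of_cond S (fun s _ => hB s) (fun s _ => hB0 s) hS
          (fun s _ => hηB s ▸ hne s) hμ
      obtain ⟨s, hs⟩ := hex
      have := hsup μ s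
      rw [relEnt, hs, EReal.coe_ennreal_top, EReal.top_sub_coe] at this
      rw [top_le_iff.1 this]; exact le_top
    · obtain ⟨hac, hint⟩ := klDiv_ne_top_iff.1 hμ
      obtain ⟨s, hs⟩ := hηf _ hint
      refine le_trans ?_ (hsup μ s)
      have hηfin : klDiv (η s : Measure E) (μ : Measure E) ≠ ∞ := by
        rw [hηB s]; exact (klDiv_cond_ne_top_iff hac (hB s) (hB0 s)).2 hint.integrableOn
      rw [relEnt_eq_coe_toReal hμ, relEnt_eq_coe_toReal hηfin, ← EReal.coe_add, ← EReal.coe_sub,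
        EReal.coe_le_coe_iff, hηB s,
        toReal_klDiv_cond hac (hB s) (hB0 s) hint.integrableOn, hlog s,
        toReal_klDiv_of_measure_eq hac (by simp)]
      rw [hηB s] at hs
      linarith
  have heq : WLC A h μs π = ((-k : ℝ) : EReal) := by
    refine le_antisymm hupper ?_
    have := hlower μs
    rwa [relEnt, klDiv_self, EReal.coe_ennreal_zero, add_zero] at this
  refine ⟨fun f hf ⟨M, hM⟩ => ?_, ?_, fun μ => ?_, fun μ hμ => ?_⟩
  · obtain ⟨s, hs⟩ := hηf f (Integrable.of_bound hf.aestronglyMeasurable M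
      (ae_of_all _ fun x => by simpa using hM x))
    exact ⟨η s, hηA s, hηh s, hs⟩
  · rw [heq, hk, EReal.coe_neg]
  · rw [heq]; exact hlower μ
  · rw [heq]
    refine lt_of_lt_of_le ?_ (hlower μ)
    have hpos : 0 < relEnt μs μ := by
      rw [relEnt, EReal.coe_ennreal_pos, pos_iff_ne_zero, Ne, klDiv_eq_zero_iff]
      exact fun h => hμ (Subtype.ext h.symm)
    by_cases hμt : klDiv (μs : Measure E) (μ : Measure E) = ∞
    · rw [relEnt, hμt, EReal.coe_ennreal_top, EReal.coe_add_top]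
      exact EReal.coe_lt_top _
    · rw [relEnt_eq_coe_toReal hμt] at hpos ⊢
      rw [← EReal.coe_add, EReal.coe_lt_coe_iff]
      have := EReal.coe_pos.1 hpos
      linarith
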